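/- Let $M$ be a smooth (Hausdorff, finite-dimensional, without boundary) real manifold, let $n\ge 1$, and let $\Lambda$ be a smooth $n$-contravariant tensor field on $M$, that is, a smooth section of $(TM)^{\otimes n}$, viewed as a smooth family of $n$-linear forms $\Lambda_x : (T_x^*M)^n\to\mathbb{R}$ (no symmetry is assumed). For smooth functions $f_1,\dots,f_n\in C^\infty(M)$ put $\{f_1,\dots,f_n\}=\Lambda(df_1,\dots,df_n)$. For $f_1,\dots,f_{n-1}\in C^\infty(M)$ let $\Lambda_{(f_1,\dots,f_{n-1})}=\{f_1,\dots,f_{n-1},\cdot\}$ be the (left) Hamiltonian vector field, obtained by contracting the first $n-1$ arguments of $\Lambda$ with $df_1,\dots,df_{n-1}$; i.e. $\langle\alpha,\Lambda_{(f_1,\dots,f_{n-1})}\rangle=\Lambda(df_1,\dots,df_{n-1},\alpha)$ for every covector $\alpha$. If $\Lambda$ is preserved by all its Hamiltonian vector fields, i.e. the Lie derivative satisfies $$\mathcal{L}_{\Lambda_{(f_1,\dots,f_{n-1})}}\Lambda=0\qquad\text{for all } f_1,\dots,f_{n-1}\in C^\infty(M),$$ then $\Lambda$ is skew-symmetric: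 $\Lambda_x(\alpha_{\sigma(1)},\dots,\alpha_{\sigma(n)})=\operatorname{sgn}(\sigma)\,\Lambda_x(\alpha_1,\dots,\alpha_n)$ for all $x\in M$, all $\alpha_1,\dots,\alpha_n\in T_x^*M$ and every permutation $\sigma$ of $\{1,\dots,n\}$. -/

import Mathlib

open scoped Manifold ContDiff Topology

noncomputable section

namespace ContraTensor

section Flat

variable {E : Type*} [NormedAddCommGroup E] [NormedSpace ℝ E] {n : ℕ}

/-- `n`-contravariant tensors on a vector space `V`: multilinear functions of `n` covectors. -/
abbrev Tensor (n : ℕ) (V : Type*) [AddCommGroup V] [Module ℝ V] [TopologicalSpace V]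
    [IsTopologicalAddGroup V] [ContinuousSMul ℝ V] : Type _ :=
  ContinuousMultilinearMap ℝ (fun _ : Fin n => V →L[ℝ] ℝ) ℝ

/-- The push-forward of an `n`-contravariant tensor by a linear map `A`:
`(A_* Λ)(ξ₁, …, ξₙ) = Λ(ξ₁ ∘ A, …, ξₙ ∘ A)`. -/
def push {V W : Type*}
    [AddCommGroup V] [Module ℝ V] [TopologicalSpace V] [IsTopologicalAddGroup V]
    [ContinuousSMul ℝ V]
    [AddCommGroup W] [Module ℝ W] [TopologicalSpace W] [IsTopologicalAddGroup W]
    [ContinuousSMul ℝ W]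
    (A : V →L[ℝ] W) (T : Tensor n V) : Tensor n W :=
  T.compContinuousLinearMap (fun _ => ContinuousLinearMap.precomp ℝ A)

/-- The Lie derivative, on a vector space `E`, of an `n`-contravariant tensor field `T` along a
vector field `V`. In linear coordinates it is the usual
`(L_V T)^{i₁…iₙ} = ∑ⱼ V^j ∂ⱼ T^{i₁…iₙ} - ∑ₖ ∑ⱼ T^{i₁…j…iₙ} ∂ⱼ V^{iₖ}`, with `j` in the `k`-th
place. -/
def lieDerivFlat (V : E → E) (T : E → Tensor n E) (y : E) : Tensor n E :=
  fderiv ℝ T y (V y) - ∑ k : Fin n, (T y).compContinuousLinearMap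
    (Function.update (fun _ => ContinuousLinearMap.id ℝ (E →L[ℝ] ℝ)) k
      (ContinuousLinearMap.precomp ℝ (fderiv ℝ V y)))

theorem lieDerivFlat_apply (V : E → E) (T : E → Tensor n E) (y : E) (ξ : Fin n → E →L[ℝ] ℝ) :
    lieDerivFlat V T y ξ = fderiv ℝ T y (V y) ξ -
      ∑ k : Fin n, T y (Function.update ξ k ((ξ k).comp (fderiv ℝ V y))) := by
  simp only [lieDerivFlat, sub_apply, sum_apply,
    ContinuousMultilinearMap.compContinuousLinearMap_apply]
  congr 1
  refine Finset.sum_congr rfl fun k _ => congrArg (T y) (funext fun i => ?_)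
  by_cases h : i = k
  · subst h
    simp
  · simp [h]

end Flat

variable {E : Type*} [NormedAddCommGroup E] [NormedSpace ℝ E]
  {H : Type*} [TopologicalSpace H] (I : ModelWithCorners ℝ E H)
  {M : Type*} [TopologicalSpace M] [ChartedSpace H M] {n : ℕ}

/-- The expression of a vector field in the preferred chart around `x₀`. -/
def vectorInChart (X : (x : M) → TangentSpace I x) (x₀ : M) (y : E) : E :=
  mfderiv I 𝓘(ℝ, E) (extChartAt I x₀) ((extChartAt I x₀).symm y) (X ((extChartAt I x₀).symm y))

/-- The expression of an `n`-contravariant tensor field in the preferred chart around `x₀`. -/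
def tensorInChart (L : (x : M) → Tensor n (TangentSpace I x)) (x₀ : M) (y : E) : Tensor n E :=
  push (W := E) (mfderiv I 𝓘(ℝ, E) (extChartAt I x₀) ((extChartAt I x₀).symm y))
    (L ((extChartAt I x₀).symm y))

/-- An `n`-contravariant tensor field is smooth if its expressions in charts are. -/
def IsSmooth (L : (x : M) → Tensor n (TangentSpace I x)) : Prop :=
  ∀ x₀ : M, ContDiffOn ℝ ∞ (tensorInChart I L x₀) (extChartAt I x₀).target

/-- The Lie derivative at `x` of the `n`-contravariant tensor field `L` along the vector field `X`,
computed in the preferred chart around `x` and carried back to the tangent space at `x`. -/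
def lieDeriv (X : (x : M) → TangentSpace I x) (L : (x : M) → Tensor n (TangentSpace I x)) (x : M) :
    Tensor n (TangentSpace I x) :=
  push (V := E) (mfderiv I 𝓘(ℝ, E) (extChartAt I x) x).inverse
    (lieDerivFlat (vectorInChart I X x) (tensorInChart I L x) (extChartAt I x x))

/-- The `n`-ary bracket `{f₁, …, fₙ} = Λ(df₁, …, dfₙ)` of functions defined by an `n`-contravariant
tensor field. -/
def bracket (L : (x : M) → Tensor n (TangentSpace I x)) (f : Fin n → M → ℝ) (x : M) : ℝ :=
  L x (fun i => mvfderiv I (f i) x)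

/-- Tangent vectors as linear functions of covectors. -/
def tangentEquiv [FiniteDimensional ℝ E] (x : M) :
    TangentSpace I x ≃ₗ[ℝ] Module.Dual ℝ (TangentSpace I x →L[ℝ] ℝ) :=
  haveI : FiniteDimensional ℝ (TangentSpace I x) := inferInstanceAs (FiniteDimensional ℝ E)
  haveI : T2Space (TangentSpace I x) := inferInstanceAs (T2Space E)
  (Module.evalEquiv ℝ (TangentSpace I x)).trans
    (LinearMap.toContinuousLinearMap (𝕜 := ℝ) (E := TangentSpace I x) (F' := ℝ)).symm.dualMap

theorem apply_tangentEquiv_symm [FiniteDimensional ℝ E] (x : M)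
    (F : Module.Dual ℝ (TangentSpace I x →L[ℝ] ℝ)) (ξ : TangentSpace I x →L[ℝ] ℝ) :
    ξ ((tangentEquiv I x).symm F) = F ξ := by
  obtain ⟨v, rfl⟩ := (tangentEquiv I x).surjective F
  rw [LinearEquiv.symm_apply_apply]
  rfl

/-- The contraction of an `(n + 1)`-contravariant tensor at `x` with `n` covectors in its first `n`
places: the tangent vector `v` with `ξ(v) = Λ(α₁, …, αₙ, ξ)` for every covector `ξ`. -/
def contract [FiniteDimensional ℝ E] {x : M} (α : Fin n → TangentSpace I x →L[ℝ] ℝ)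
    (T : Tensor (n + 1) (TangentSpace I x)) : TangentSpace I x :=
  (tangentEquiv I x).symm
    (T.toMultilinearMap.toLinearMap (Fin.snoc α 0) (Fin.last n))

theorem apply_contract [FiniteDimensional ℝ E] {x : M} (α : Fin n → TangentSpace I x →L[ℝ] ℝ)
    (T : Tensor (n + 1) (TangentSpace I x)) (ξ : TangentSpace I x →L[ℝ] ℝ) :
    ξ (contract I α T) = T (Fin.snoc α ξ) := by
  rw [contract, apply_tangentEquiv_symm]
  simp [MultilinearMap.toLinearMap_apply, Fin.update_snoc_last]

/-- The (left) Hamiltonian vector field of `f₁, …, fₙ`: the contraction of the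
`(n + 1)`-contravariant tensor field `L` with `df₁, …, dfₙ`. -/
def hamiltonian [FiniteDimensional ℝ E] (L : (x : M) → Tensor (n + 1) (TangentSpace I x))
    (f : Fin n → M → ℝ) (x : M) : TangentSpace I x :=
  contract I (fun i => mvfderiv I (f i) x) (L x)

/-- The Hamiltonian vector field of `f₁, …, fₙ` acts on functions as `{f₁, …, fₙ, ·}`. -/
theorem mvfderiv_hamiltonian [FiniteDimensional ℝ E]
    (L : (x : M) → Tensor (n + 1) (TangentSpace I x)) (f : Fin n → M → ℝ) (g : M → ℝ) (x : M) :
    mvfderiv I g x (hamiltonian I L f x) =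
      bracket I L (Fin.snoc (α := fun _ => M → ℝ) f g) x := by
  rw [hamiltonian, apply_contract, bracket]
  congr 1
  funext i
  refine Fin.lastCases ?_ (fun j => ?_) i <;> simp

/-- An `n`-contravariant tensor field is skew-symmetric if permuting its arguments multiplies its
values by the sign of the permutation. -/
def IsSkewSymmetric (L : (x : M) → Tensor n (TangentSpace I x)) : Prop :=
  ∀ (x : M) (σ : Equiv.Perm (Fin n)) (ξ : Fin n → TangentSpace I x →L[ℝ] ℝ),
    L x (fun i => ξ (σ i)) = ((Equiv.Perm.sign σ : ℤ) : ℝ) * L x ξ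

end ContraTensor

end

/-- If `∑ₖ T(α, ξₖ) T(ξ with αⱼ in place k) = 0` for all `α`, `ξ`, `j`, then `T` vanishes whenever
its last argument repeats another one. -/
theorem eq_zero_of_sum_mul_update_eq_zero {V : Type*} {n : ℕ} (T : (Fin (n + 1) → V) → ℝ)
    (h : ∀ (α : Fin n → V) (ξ : Fin (n + 1) → V) (j : Fin n),
      ∑ k, T (Fin.snoc α (ξ k)) * T (Function.update ξ k (α j)) = 0)
    (α : Fin n → V) (j : Fin n) : T (Fin.snoc α (α j)) = 0 := by
  by_contra hc
  have key : ∀ s : Finset (Fin (n + 1)), s ≠ Finset.univ →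
      ∀ ξ : Fin (n + 1) → V, (∀ k ∉ s, ξ k = α j) → T ξ = 0 := by
    intro s
    induction s using Finset.strongInduction with
    | H s ih =>
      intro hs ξ hξ
      have hsum := h α ξ j
      have hterm : ∀ k, T (Fin.snoc α (ξ k)) * T (Function.update ξ k (α j)) =
          if k ∈ s then 0 else T (Fin.snoc α (α j)) * T ξ := by
        intro k
        split_ifs with hk
        · refine mul_eq_zero_of_right _ (ih (s.erase k) (Finset.erase_ssubset hk)
            (fun he => hs (Finset.eq_univ_of_forall fun i =>
              Finset.mem_of_mem_erase (he ▸ Finset.mem_univ i))) _ fun i hi => ?_)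
          by_cases hik : i = k
          · simp [hik]
          · rw [Function.update_of_ne hik]
            exact hξ i fun his => hi (Finset.mem_erase.2 ⟨hik, his⟩)
        · rw [hξ k hk]
          congr 2
          rw [← hξ k hk, Function.update_eq_self]
      simp only [hterm] at hsum
      rw [Finset.sum_ite, Finset.sum_const_zero, zero_add, Finset.sum_const, nsmul_eq_mul] at hsum
      obtain ⟨k, hk⟩ : ∃ k, k ∉ s := by
        by_contra! hall
        exact hs (Finset.eq_univ_of_forall hall)
      have hcard : ((Finset.univ.filter (· ∉ s)).card : ℝ) ≠ 0 :=
        Nat.cast_ne_zero.2 (Finset.card_ne_zero.2 ⟨k, by simpa using hk⟩)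
      simpa [hcard, hc] using hsum
  refine hc (key (Finset.univ.erase j.castSucc) (by simp) _ fun k hk => ?_)
  obtain rfl : k = j.castSucc := by simpa using hk
  simp

/-- A multilinear map that vanishes whenever its last argument repeats another one is
skew-symmetric. -/
theorem MultilinearMap.map_perm_of_snoc_eq_zero {V : Type*} [AddCommGroup V] [Module ℝ V] {n : ℕ}
    (T : MultilinearMap ℝ (fun _ : Fin (n + 1) => V) ℝ)
    (h : ∀ (α : Fin n → V) (j : Fin n), T (Fin.snoc α (α j)) = 0)
    (σ : Equiv.Perm (Fin (n + 1))) (ξ : Fin (n + 1) → V) :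
    T (fun i => ξ (σ i)) = ((Equiv.Perm.sign σ : ℤ) : ℝ) * T ξ := by
  have hz : ∀ (v : Fin (n + 1) → V) (j : Fin n), v j.castSucc = v (Fin.last n) → T v = 0 := by
    intro v j hv
    have := h (fun i => v i.castSucc) j
    rw [hv] at this
    rwa [← Fin.snoc_init_self v]
  have hlast : ∀ (j : Fin n) (v : Fin (n + 1) → V),
      T (fun i => v (Equiv.swap j.castSucc (Fin.last n) i)) = -T v := by
    intro j v
    have hj : j.castSucc ≠ Fin.last n := (Fin.castSucc_lt_last j).ne
    let F : V → V → Fin (n + 1) → V := fun x y =>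
      Function.update (Function.update v j.castSucc x) (Fin.last n) y
    have hF : ∀ x, T (F x x) = 0 := fun x => hz _ j (by simp [F, hj])
    have hadd : ∀ x y, T (F (x + y) (x + y)) = T (F x x) + T (F x y) + T (F y x) + T (F y y) := by
      intro x y
      have hl : ∀ z, T (F (x + y) z) = T (F x z) + T (F y z) := by
        intro z
        simp only [F, Function.update_comm hj]
        exact T.map_update_add _ _ _ _
      have hr : ∀ z, T (F z (x + y)) = T (F z x) + T (F z y) :=
        fun z => T.map_update_add _ _ _ _
      rw [hr, hl, hl]
      ring
    have hxy := hadd (v j.castSucc) (v (Fin.last n))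
    simp only [hF] at hxy
    have h1 : F (v j.castSucc) (v (Fin.last n)) = v := by simp [F]
    have h2 : F (v (Fin.last n)) (v j.castSucc) =
        fun i => v (Equiv.swap j.castSucc (Fin.last n) i) := by
      funext i
      by_cases hi : i = Fin.last n
      · simp [F, hi]
      · by_cases hi' : i = j.castSucc
        · simp [F, hi', hj]
        · simp [F, hi, hi', Equiv.swap_apply_of_ne_of_ne]
    rw [h1, h2] at hxy
    linarith
  have hswap_last : ∀ (i : Fin (n + 1)), i ≠ Fin.last n → ∀ v : Fin (n + 1) → V,
      T (fun k => v (Equiv.swap i (Fin.last n) k)) = -T v := by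
    intro i hi v
    obtain ⟨j, rfl⟩ := Fin.exists_castSucc_eq.2 hi
    exact hlast j v
  have hswap : ∀ i j : Fin (n + 1), i ≠ j → ∀ v : Fin (n + 1) → V,
      T (fun k => v (Equiv.swap i j k)) = -T v := by
    intro i j hij v
    by_cases hj : j = Fin.last n
    · subst hj
      exact hswap_last i hij v
    by_cases hi : i = Fin.last n
    · subst hi
      rw [Equiv.swap_comm]
      exact hswap_last j hj v
    · have e := Equiv.swap_mul_swap_mul_swap (x := j) (y := Fin.last n) (z := i) hj hij.symm
      rw [← e, Equiv.swap_comm (Fin.last n) i]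
      simp only [Equiv.Perm.mul_apply]
      rw [hswap_last i hi (fun m => v (Equiv.swap i (Fin.last n) (Equiv.swap j (Fin.last n) m))),
        hswap_last j hj (fun m => v (Equiv.swap i (Fin.last n) m)), hswap_last i hi, neg_neg]
  induction σ using Equiv.Perm.swap_induction_on generalizing ξ with
  | one => simp
  | swap_mul f x y hxy ih =>
    have := ih (fun i => ξ (Equiv.swap x y i))
    simp only [Equiv.Perm.mul_apply]
    rw [this, hswap x y hxy]
    simp [Equiv.Perm.sign_swap hxy]

/-- A map into a finite-dimensional space is differentiable as soon as its composition with every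
linear form is. -/
theorem hasFDerivAt_of_forall_dual {F E : Type*} [NormedAddCommGroup F] [NormedSpace ℝ F]
    [NormedAddCommGroup E] [NormedSpace ℝ E] [FiniteDimensional ℝ E]
    {V : F → E} {A : F →L[ℝ] E} {y : F}
    (h : ∀ ξ : E →L[ℝ] ℝ, HasFDerivAt (fun z => ξ (V z)) (ξ.comp A) y) : HasFDerivAt V A y := by
  let e := (Module.finBasis ℝ E).equivFunL
  rw [← e.comp_hasFDerivAt_iff, hasFDerivAt_pi']
  intro i
  exact h ((ContinuousLinearMap.proj (R := ℝ) (φ := fun _ => ℝ) i).comp (e : E →L[ℝ] _))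

section Chart

variable {E : Type*} [NormedAddCommGroup E] [NormedSpace ℝ E]
  {H : Type*} [TopologicalSpace H] (I : ModelWithCorners ℝ E H)
  {M : Type*} [TopologicalSpace M] [ChartedSpace H M]

/-- Every smooth function on the model space is, near a given point, the chart expression of a
globally defined smooth function. -/
theorem exists_contMDiff_eventuallyEq_comp_extChartAt [FiniteDimensional ℝ E] [IsManifold I ∞ M]
    [T2Space M] (x : M) {g : E → ℝ} (hg : ContDiff ℝ ∞ g) :
    ∃ f : M → ℝ, ContMDiff I 𝓘(ℝ, ℝ) ∞ f ∧ f =ᶠ[𝓝 x] g ∘ extChartAt I x := by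
  obtain ⟨χ⟩ : Nonempty (SmoothBumpFunction I x) := inferInstance
  refine ⟨fun z => χ z • (g ∘ extChartAt I x) z,
    χ.contMDiff_smul (hg.contMDiff.comp_contMDiffOn (contMDiffOn_extChartAt (n := ∞))), ?_⟩
  filter_upwards [χ.eventuallyEq_one] with z hz
  simp [hz]

theorem mvfderiv_comp_extChartAt [IsManifold I ∞ M] {x₀ x : M} {f : M → ℝ} {g : E → ℝ}
    (hg : ContDiff ℝ ∞ g) (hf : f =ᶠ[𝓝 x] g ∘ extChartAt I x₀)
    (hx : x ∈ (chartAt H x₀).source) :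
    mvfderiv I f x = (fderiv ℝ g (extChartAt I x₀ x)).comp
      (mfderiv I 𝓘(ℝ, E) (extChartAt I x₀) x) := by
  have : IsManifold I 1 M := IsManifold.of_le (n := ∞) (by simp)
  have hgd : DifferentiableAt ℝ g (extChartAt I x₀ x) := hg.differentiable (by simp) _
  have e : mfderiv I 𝓘(ℝ, ℝ) f x = (fderiv ℝ g (extChartAt I x₀ x)).comp
      (mfderiv I 𝓘(ℝ, E) (extChartAt I x₀) x) := by
    rw [hf.mfderiv_eq, mfderiv_comp x hgd.mdifferentiableAt (mdifferentiableAt_extChartAt hx),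
      mfderiv_eq_fderiv]
    rfl
  ext v
  exact DFunLike.congr_fun e v

end Chart

namespace ContraTensor

variable {E : Type*} [NormedAddCommGroup E] [NormedSpace ℝ E]
  {H : Type*} [TopologicalSpace H] (I : ModelWithCorners ℝ E H)
  {M : Type*} [TopologicalSpace M] [ChartedSpace H M] {n : ℕ}

theorem push_apply {V W : Type*}
    [AddCommGroup V] [Module ℝ V] [TopologicalSpace V] [IsTopologicalAddGroup V]
    [ContinuousSMul ℝ V]
    [AddCommGroup W] [Module ℝ W] [TopologicalSpace W] [IsTopologicalAddGroup W]
    [ContinuousSMul ℝ W]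
    (A : V →L[ℝ] W) (T : Tensor n V) (ξ : Fin n → W →L[ℝ] ℝ) :
    push A T ξ = T (fun i => (ξ i).comp A) := rfl

/-- At a zero of the vector field whose linearization has rank one, the Lie derivative is
algebraic. -/
theorem lieDerivFlat_apply_of_hasFDerivAt {V : E → E} {T : E → Tensor n E} {y w : E}
    {β : E →L[ℝ] ℝ} (hV0 : V y = 0) (hV : HasFDerivAt V (β.smulRight w) y)
    (ξ : Fin n → E →L[ℝ] ℝ) :
    lieDerivFlat V T y ξ = -∑ k, ξ k w * T y (Function.update ξ k β) := by
  rw [lieDerivFlat_apply, hV0, hV.fderiv]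
  simp only [map_zero, zero_apply, zero_sub, neg_inj]
  refine Finset.sum_congr rfl fun k _ => ?_
  have : (ξ k).comp (β.smulRight w) = ξ k w • β := by
    ext v
    simp [mul_comm]
  rw [this, ContinuousMultilinearMap.map_update_smul, smul_eq_mul]

/-- The differential of the preferred chart at its base point, as an isomorphism from the tangent
space to the model space, transports tensor fields and Lie derivatives. -/
theorem exists_tangentSpace_equiv [IsManifold I ∞ M] (x : M) :
    ∃ B : TangentSpace I x ≃L[ℝ] E,
      (∀ (L : (x : M) → Tensor n (TangentSpace I x)) (ξ : Fin n → E →L[ℝ] ℝ),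
        tensorInChart I L x (extChartAt I x x) ξ =
          L x (fun i => (ξ i).comp (B : TangentSpace I x →L[ℝ] E))) ∧
      ∀ (X : (x : M) → TangentSpace I x) (L : (x : M) → Tensor n (TangentSpace I x))
        (η : Fin n → TangentSpace I x →L[ℝ] ℝ),
        lieDeriv I X L x η =
          lieDerivFlat (vectorInChart I X x) (tensorInChart I L x) (extChartAt I x x)
            (fun i => (η i).comp (B.symm : E →L[ℝ] TangentSpace I x)) := by
  have : IsManifold I 1 M := IsManifold.of_le (n := ∞) (by simp)
  obtain ⟨A, hA⟩ := isInvertible_mfderiv_extChartAt (I := I) (mem_extChartAt_source (I := I) x)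
  let B : TangentSpace I x ≃L[ℝ] E := A
  refine ⟨B, fun L ξ => ?_, fun X L η => ?_⟩
  · have h : tensorInChart I L x (extChartAt I x x) ξ =
        L x (fun i => (ξ i).comp (mfderiv I 𝓘(ℝ, E) (extChartAt I x) x)) := by
      change L ((extChartAt I x).symm (extChartAt I x x)) (fun i => (ξ i).comp
        (mfderiv I 𝓘(ℝ, E) (extChartAt I x) ((extChartAt I x).symm (extChartAt I x x)))) = _
      rw [extChartAt_to_inv]
    rw [h, ← hA]
    rfl
  · rw [lieDeriv, ← hA, ContinuousLinearMap.inverse_equiv]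
    rfl

theorem lieDerivFlat_eq_zero [IsManifold I ∞ M] {X : (x : M) → TangentSpace I x}
    {L : (x : M) → Tensor n (TangentSpace I x)} {x : M} (h : lieDeriv I X L x = 0) :
    lieDerivFlat (vectorInChart I X x) (tensorInChart I L x) (extChartAt I x x) = 0 := by
  obtain ⟨B, -, hB⟩ := exists_tangentSpace_equiv I x (n := n)
  ext ξ
  have h' := hB X L (fun i => (ξ i).comp (B : TangentSpace I x →L[ℝ] E))
  have hξ : ∀ i, ((ξ i).comp (B : TangentSpace I x →L[ℝ] E)).comp
      (B.symm : E →L[ℝ] TangentSpace I x) = ξ i := by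
    intro i
    ext v
    exact congrArg (ξ i) (B.apply_symm_apply v)
  simp only [hξ] at h'
  rw [← h', h]
  rfl

/-- Linear forms evaluate the chart expression of a Hamiltonian vector field through the chart
expression of the tensor field. -/
theorem apply_vectorInChart_hamiltonian [FiniteDimensional ℝ E]
    (L : (x : M) → Tensor (n + 1) (TangentSpace I x)) (f : Fin n → M → ℝ) (x₀ : M) (y : E)
    (δ : Fin n → E →L[ℝ] ℝ)
    (hδ : ∀ i, mvfderiv I (f i) ((extChartAt I x₀).symm y) = (δ i).comp
      (mfderiv I 𝓘(ℝ, E) (extChartAt I x₀) ((extChartAt I x₀).symm y)))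
    (ξ : E →L[ℝ] ℝ) :
    ξ (vectorInChart I (hamiltonian I L f) x₀ y) = tensorInChart I L x₀ y (Fin.snoc δ ξ) := by
  have hsnoc : (fun i => ((Fin.snoc δ ξ : Fin (n + 1) → E →L[ℝ] ℝ) i).comp
      (mfderiv I 𝓘(ℝ, E) (extChartAt I x₀) ((extChartAt I x₀).symm y))) =
      Fin.snoc (α := fun _ => TangentSpace I ((extChartAt I x₀).symm y) →L[ℝ] ℝ)
        (fun i => mvfderiv I (f i) ((extChartAt I x₀).symm y))
        (ξ.comp (mfderiv I 𝓘(ℝ, E) (extChartAt I x₀) ((extChartAt I x₀).symm y))) := by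
    funext i
    refine Fin.lastCases ?_ (fun j => ?_) i
    · rw [Fin.snoc_last, Fin.snoc_last]
    · rw [Fin.snoc_castSucc, Fin.snoc_castSucc, hδ]
  refine (apply_contract I _ (L ((extChartAt I x₀).symm y)) (ξ.comp
    (mfderiv I 𝓘(ℝ, E) (extChartAt I x₀) ((extChartAt I x₀).symm y)))).trans ?_
  exact congrArg (L ((extChartAt I x₀).symm y)) hsnoc.symm

/-- The pointwise identity satisfied by a tensor field preserved by its Hamiltonian vector
fields. -/
theorem sum_tensorInChart_mul_update_eq_zero [FiniteDimensional ℝ E] [I.Boundaryless]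
    [IsManifold I ∞ M] [T2Space M] (L : (x : M) → Tensor (n + 1) (TangentSpace I x))
    (hL : IsSmooth I L)
    (hpres : ∀ f : Fin n → M → ℝ, (∀ i, ContMDiff I 𝓘(ℝ, ℝ) ∞ (f i)) →
      ∀ x : M, lieDeriv I (hamiltonian I L f) L x = 0)
    (x₀ : M) (α : Fin n → E →L[ℝ] ℝ) (ξ : Fin (n + 1) → E →L[ℝ] ℝ) (j : Fin n) :
    ∑ k, tensorInChart I L x₀ (extChartAt I x₀ x₀) (Fin.snoc α (ξ k)) *
      tensorInChart I L x₀ (extChartAt I x₀ x₀) (Function.update ξ k (α j)) = 0 := by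
  classical
  set y₀ : E := extChartAt I x₀ x₀ with hy₀
  set T := tensorInChart I L x₀ with hT
  have hTd : DifferentiableAt ℝ T y₀ :=
    ((hL x₀).contDiffAt (extChartAt_target_mem_nhds x₀)).differentiableAt (by simp)
  -- `g i` has differential `α i` for `i ≠ j`, while `d (g j) = α j (y - y₀) • α j`
  let g : Fin n → E → ℝ := fun i y => if i = j then α j (y - y₀) ^ 2 / 2 else α i y
  have hg : ∀ i, ContDiff ℝ ∞ (g i) := by
    intro i
    by_cases hi : i = j
    · simp only [g, hi, if_true]
      fun_prop
    · simp only [g, hi, if_false]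
      fun_prop
  let δ : E → Fin n → E →L[ℝ] ℝ := fun y => Function.update α j (α j (y - y₀) • α j)
  have hgδ : ∀ i y, fderiv ℝ (g i) y = δ y i := by
    intro i y
    by_cases hi : i = j
    · subst hi
      have h1 : HasFDerivAt (fun y => α i (y - y₀)) (α i) y :=
        (α i).hasFDerivAt.comp y ((hasFDerivAt_id y).sub_const y₀)
      have h2 := ((h1.pow 2).mul_const (2⁻¹ : ℝ)).fderiv
      have h3 : g i = fun y => α i (y - y₀) ^ 2 * 2⁻¹ := by
        funext y
        simp [g, div_eq_mul_inv]
      rw [h3, h2]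
      ext v
      simp [δ]
      ring
    · have h3 : g i = α i := by
        funext y
        simp [g, hi]
      rw [h3, ContinuousLinearMap.fderiv]
      simp [δ, hi]
  choose f hfs hfg using fun i => exists_contMDiff_eventuallyEq_comp_extChartAt I x₀ (hg i)
  have hev : ∀ᶠ y in 𝓝 y₀, ∀ ζ : E →L[ℝ] ℝ, ζ (vectorInChart I (hamiltonian I L f) x₀ y) =
      α j (y - y₀) * T y (Fin.snoc α ζ) := by
    have hnear : ∀ᶠ x in 𝓝 x₀, x ∈ (chartAt H x₀).source ∧
        ∀ i, f i =ᶠ[𝓝 x] g i ∘ extChartAt I x₀ :=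
      Filter.Eventually.and ((chartAt H x₀).open_source.mem_nhds (mem_chart_source H x₀))
        (Filter.eventually_all.2 fun i => (hfg i).eventuallyEq_nhds)
    have hsymm : Filter.Tendsto (extChartAt I x₀).symm (𝓝 y₀) (𝓝 x₀) := by
      have := continuousAt_extChartAt_symm (I := I) x₀
      rwa [ContinuousAt, extChartAt_to_inv] at this
    filter_upwards [hsymm.eventually hnear, extChartAt_target_mem_nhds (I := I) x₀] with y hy hyt ζ
    rw [apply_vectorInChart_hamiltonian I L f x₀ y (δ y) _ ζ]
    · have : (Fin.snoc (δ y) ζ : Fin (n + 1) → E →L[ℝ] ℝ) =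
          Function.update (Fin.snoc α ζ) j.castSucc (α j (y - y₀) • α j) := by
        simp [δ, Fin.snoc_update]
      have h2 : Function.update (Fin.snoc α ζ : Fin (n + 1) → E →L[ℝ] ℝ) j.castSucc (α j) =
          Fin.snoc α ζ := by
        simp [← Fin.snoc_update]
      rw [this, ContinuousMultilinearMap.map_update_smul, h2, smul_eq_mul]
    · intro i
      rw [mvfderiv_comp_extChartAt I (hg i) (hy.2 i) hy.1, (extChartAt I x₀).right_inv hyt, hgδ]
  set V := vectorInChart I (hamiltonian I L f) x₀ with hVdef
  let w : E := (tangentEquiv 𝓘(ℝ, E) y₀).symm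
    ((T y₀).toMultilinearMap.toLinearMap (Fin.snoc α 0) (Fin.last n))
  have hw : ∀ ζ : E →L[ℝ] ℝ, ζ w = T y₀ (Fin.snoc α ζ) :=
    fun ζ => apply_contract (n := n) 𝓘(ℝ, E) (x := y₀) α (T y₀) ζ
  have hV0 : V y₀ = 0 := by
    refine SeparatingDual.eq_zero_of_forall_dual_eq_zero (R := ℝ) fun ζ => ?_
    simpa using hev.self_of_nhds ζ
  have hV : HasFDerivAt V ((α j).smulRight w) y₀ := by
    refine hasFDerivAt_of_forall_dual fun ζ => ?_
    have h1 : HasFDerivAt (fun y => α j (y - y₀)) (α j) y₀ :=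
      (α j).hasFDerivAt.comp y₀ ((hasFDerivAt_id y₀).sub_const y₀)
    have h2 : DifferentiableAt ℝ (fun y => T y (Fin.snoc α ζ)) y₀ :=
      hTd.continuousMultilinear_apply_const (Fin.snoc α ζ)
    have h3 := (h1.mul h2.hasFDerivAt).congr_of_eventuallyEq (hev.mono fun y hy => hy ζ)
    refine h3.congr_fderiv ?_
    ext v
    simp [hw, mul_comm]
  have hzero := DFunLike.congr_fun (lieDerivFlat_eq_zero I (hpres f hfs x₀)) ξ
  rw [lieDerivFlat_apply_of_hasFDerivAt hV0 hV] at hzero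
  simpa [hw] using hzero

end ContraTensor

theorem corollary1
    {E : Type*} [NormedAddCommGroup E] [NormedSpace ℝ E] [FiniteDimensional ℝ E]
    {H : Type*} [TopologicalSpace H] (I : ModelWithCorners ℝ E H) [I.Boundaryless]
    {M : Type*} [TopologicalSpace M] [ChartedSpace H M] [IsManifold I ∞ M] [T2Space M]
    (n : ℕ) (L : (x : M) → ContraTensor.Tensor (n + 1) (TangentSpace I x))
    (hL : ContraTensor.IsSmooth I L)
    (hpres : ∀ f : Fin n → M → ℝ, (∀ i, ContMDiff I 𝓘(ℝ, ℝ) ∞ (f i)) →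
      ∀ x : M, ContraTensor.lieDeriv I (ContraTensor.hamiltonian I L f) L x = 0) :
    ContraTensor.IsSkewSymmetric I L := by
  intro x σ ξ
  obtain ⟨A, hT, -⟩ := ContraTensor.exists_tangentSpace_equiv I x (n := n + 1)
  have hξ : ∀ i, ((ξ i).comp (A.symm : E →L[ℝ] TangentSpace I x)).comp
      (A : TangentSpace I x →L[ℝ] E) = ξ i := by
    intro i
    ext v
    exact congrArg (ξ i) (A.symm_apply_apply v)
  have key := MultilinearMap.map_perm_of_snoc_eq_zero
    (ContraTensor.tensorInChart I L x (extChartAt I x x)).toMultilinearMap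
    (eq_zero_of_sum_mul_update_eq_zero _
      (ContraTensor.sum_tensorInChart_mul_update_eq_zero I L hL hpres x)) σ
    (fun i => (ξ i).comp (A.symm : E →L[ℝ] TangentSpace I x))
  simp only [ContinuousMultilinearMap.coe_coe] at key
  rw [hT, hT] at key
  simpa only [hξ] using key
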